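/- Let $\mathcal S$ be a measurable space (states) and $\mathcal A$ a nonempty standard Borel space (actions). Let $\mathcal T$ be a probability distribution over tasks $\mathcal M=(\mathcal S,\mathcal A,\mathcal P,\mathcal R_{\mathcal M},\gamma)$ that share the initial state distribution, the transition kernel $\mathcal P(\cdot\mid s,a)$ and the discount factor $\gamma\in(0,1)$ and differ only in the reward function $\mathcal R_{\mathcal M}:\mathcal S\times\mathcal A\to\mathbb R$. Assume that $\mathcal R_{\mathcal M}(s,a)$ is jointly measurable in $(\mathcal M,s,a)$ and that $|\mathcal R_{\mathcal M}(s,a)|\le C(\mathcal M)$ for all $\mathcal M,s,a$, for some $C$ with $\mathbb E_{\mathcal M\sim\mathcal T}[C(\mathcal M)]<\infty$. A policy $\pi$ chooses, measurably, at each time $t$ a distribution of the action $a_t$ from the history $(s_0,a_0,r_0,\dots,s_{t-1},a_{t-1},r_{t-1},s_t)$, where $s_{t+1}\sim\mathcal P(\cdot\mid s_t,a_t)$ and $r_t=\mathcal R_{\mathcal M}(s_t,a_t)$; let $J_{\mathcal M}(\pi)=\mathbb E\big[\sum_{t=0}^\infty\gamma^t r_t\big]$. Let $\Pi_1$ be the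 set of Markovian policies, $\pi:\mathcal S\to\Delta(\mathcal A)$ (stationary, depending on $s_t$ only), and $\Pi_2$ the set of policies that depend on $(s_0,a_0,\dots,s_{t-1},a_{t-1},s_t)$ but not on the rewards. Put $$J^i_{\mathcal T}=\sup_{\pi\in\Pi_i}\mathbb E_{\mathcal M\sim\mathcal T}[J_{\mathcal M}(\pi)]\quad(i=1,2),\qquad J^*_{\mathcal T}=\mathbb E_{\mathcal M\sim\mathcal T}\Big[\sup_{\pi}J_{\mathcal M}(\pi)\Big],$$ where the last supremum is over all policies (and the last expectation is read as a lower integral, which is the ordinary expectation whenever $\mathcal M\mapsto\sup_\pi J_{\mathcal M}(\pi)$ is measurable). Let $\bar{\mathcal M}=(\mathcal S,\mathcal A,\mathcal P,\bar{\mathcal R},\gamma)$, with the same initial distribution and $\bar{\mathcal R}(s,a)=\mathbb E_{\mathcal M\sim\mathcal T}[\mathcal R_{\mathcal M}(s,a)]$. Then for every $\pi\in\Pi_2$ the function $\mathcal M\mapsto J_{\mathcal M}(\pi)$ is integrable and $$\mathbb E_{\mathcal M\sim\mathcal T}[J_{\mathcal M}(\pi)]=J_{\bar{\mathcal M}}(\pi).$$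 Moreover $$J^1_{\mathcal T}=J^2_{\mathcal T}\le J^*_{\mathcal T},$$ and the supremum defining $J^1_{\mathcal T}$ is attained if and only if the one defining $J^2_{\mathcal T}$ is; in that case the two maxima are equal. -/

import Mathlib

open MeasureTheory ProbabilityTheory

/-- A discounted Markov decision process on the measurable spaces `S` (states) and `A` (actions):
initial state law, transition kernel, reward function of the current state and action, and a
discount factor in `(0, 1)`. -/
structure MDP (S A : Type*) [MeasurableSpace S] [MeasurableSpace A] where
  init : Measure S
  init_prob : IsProbabilityMeasure init
  trans : Kernel (S × A) S
  trans_markov : IsMarkovKernel trans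
  reward : S × A → ℝ
  reward_measurable : Measurable reward
  discount : ℝ
  discount_pos : 0 < discount
  discount_lt_one : discount < 1

/-- One time step `(s, a, r)` of a trajectory: state, action, reward. -/
abbrev Step (S A : Type*) := S × A × ℝ

/-- A general (randomized) policy: at each time `t` it chooses the law of the action from the past
states, actions and rewards `(s₀, a₀, r₀, …, s_{t-1}, a_{t-1}, r_{t-1})` and the current state.
The type of all policies is the policy class `Π₃`. -/
structure Policy (S A : Type*) [MeasurableSpace S] [MeasurableSpace A] where
  kernel : (t : ℕ) → Kernel ((Fin t → Step S A) × S) A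
  markov : ∀ t, IsMarkovKernel (kernel t)

attribute [instance] MDP.init_prob MDP.trans_markov Policy.markov

noncomputable section

/-- Forget the past rewards in a history. -/
def forgetRewards (S A : Type*) (t : ℕ) (h : (Fin t → Step S A) × S) : (Fin t → S × A) × S :=
  (fun i => ((h.1 i).1, (h.1 i).2.1), h.2)

theorem measurable_forgetRewards (S A : Type*) [MeasurableSpace S] [MeasurableSpace A] (t : ℕ) :
    Measurable (forgetRewards S A t) := by
  unfold forgetRewards
  fun_prop

/-- `Π₁`: Markovian policies; one kernel from the current state to actions, used at all times. -/
def markovPolicies (S A : Type*) [MeasurableSpace S] [MeasurableSpace A] : Set (Policy S A) :=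
  {π | ∃ κ : Kernel S A, IsMarkovKernel κ ∧
    ∀ t, π.kernel t = κ.comap Prod.snd measurable_snd}

/-- `Π₂`: policies that depend on past states and actions and the current state, but not on past
rewards. -/
def stateActionPolicies (S A : Type*) [MeasurableSpace S] [MeasurableSpace A] :
    Set (Policy S A) :=
  {π | ∃ κ : (t : ℕ) → Kernel ((Fin t → S × A) × S) A, (∀ t, IsMarkovKernel (κ t)) ∧
    ∀ t, π.kernel t = (κ t).comap (forgetRewards S A t) (measurable_forgetRewards S A t)}

namespace MDP

variable {S A : Type*} [MeasurableSpace S] [MeasurableSpace A]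

/-- Given the past and the current state `s`, draw the action `a` from the policy, receive the
reward `R(s, a)`, and record `(s, a, R(s, a))`. -/
def actKernel (M : MDP S A) (π : Policy S A) (t : ℕ) :
    Kernel ((Fin t → Step S A) × S) (Step S A) :=
  (Kernel.id ×ₖ π.kernel t).map
    (fun p : ((Fin t → Step S A) × S) × A => (p.1.2, p.2, M.reward (p.1.2, p.2)))

instance (M : MDP S A) (π : Policy S A) (t : ℕ) : IsMarkovKernel (M.actKernel π t) := by
  have := M.reward_measurable
  exact Kernel.IsMarkovKernel.map _ (by fun_prop)

/-- The law of the step at time `0`: the state is drawn from the initial law. -/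
def firstStep (M : MDP S A) (π : Policy S A) : Measure (Step S A) :=
  (M.init.map (fun s => ((fun i => i.elim0 : Fin 0 → Step S A), s))).bind (M.actKernel π 0)

instance (M : MDP S A) (π : Policy S A) : IsProbabilityMeasure (M.firstStep π) := by
  have : IsProbabilityMeasure
      (M.init.map (fun s => ((fun i => i.elim0 : Fin 0 → Step S A), s))) :=
    Measure.isProbabilityMeasure_map (by fun_prop)
  unfold firstStep
  infer_instance

/-- The steps at times `0, …, n` as a family indexed by `Fin (n + 1)`. -/
def pastSteps (n : ℕ) (h : (i : Finset.Iic n) → Step S A) : Fin (n + 1) → Step S A :=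
  fun i => h ⟨i, Finset.mem_Iic.2 (Nat.lt_succ_iff.1 i.isLt)⟩

/-- The state and the action at time `n`. -/
def lastPair (n : ℕ) (h : (i : Finset.Iic n) → Step S A) : S × A :=
  ((h ⟨n, Finset.mem_Iic.2 le_rfl⟩).1, (h ⟨n, Finset.mem_Iic.2 le_rfl⟩).2.1)

theorem measurable_pastSteps (n : ℕ) : Measurable (pastSteps (S := S) (A := A) n) := by
  unfold pastSteps
  fun_prop

theorem measurable_lastPair (n : ℕ) : Measurable (lastPair (S := S) (A := A) n) := by
  unfold lastPair
  fun_prop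

/-- The law of the step at time `n + 1` given the steps at times `0, …, n`: the next state is drawn
from the transition kernel, then the policy acts. -/
def nextStep (M : MDP S A) (π : Policy S A) (n : ℕ) :
    Kernel ((i : Finset.Iic n) → Step S A) (Step S A) :=
  M.actKernel π (n + 1) ∘ₖ
    (Kernel.deterministic (pastSteps n) (measurable_pastSteps n) ×ₖ
      M.trans.comap (lastPair n) (measurable_lastPair n))

instance (M : MDP S A) (π : Policy S A) (n : ℕ) : IsMarkovKernel (M.nextStep π n) := by
  unfold nextStep
  infer_instance

/-- The law of the infinite trajectory `(s₀, a₀, r₀, s₁, a₁, r₁, …)` generated by `π` in `M`. -/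
def trajLaw (M : MDP S A) (π : Policy S A) : Measure (ℕ → Step S A) :=
  Kernel.trajMeasure (X := fun _ => Step S A) (M.firstStep π) (M.nextStep π)

/-- The expected discounted return `J_M(π)`. -/
def value (M : MDP S A) (π : Policy S A) : ℝ :=
  ∫ τ, ∑' t, M.discount ^ t * (τ t).2.2 ∂(M.trajLaw π)

/-- The optimal return `sup_π J_M(π)` over all policies. -/
def optValue (M : MDP S A) : ℝ := ⨆ π : Policy S A, M.value π

end MDP

/-- The lower integral of a real function: the supremum of the integrals of its integrable
minorants. It is the integral whenever the function is integrable, see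
`lowerExpectation_eq_integral`, and it is meaningful for suprema over uncountable families, which
need not be measurable. -/
def lowerExpectation {Θ : Type*} [MeasurableSpace Θ] (μ : Measure Θ) (f : Θ → ℝ) : ℝ :=
  sSup {c | ∃ g : Θ → ℝ, Integrable g μ ∧ (∀ θ, g θ ≤ f θ) ∧ c = ∫ θ, g θ ∂μ}

theorem lowerExpectation_eq_integral {Θ : Type*} [MeasurableSpace Θ] (μ : Measure Θ) (f : Θ → ℝ)
    (hf : Integrable f μ) : lowerExpectation μ f = ∫ θ, f θ ∂μ := by
  refine IsGreatest.csSup_eq ⟨⟨f, hf, fun _ => le_rfl, rfl⟩, ?_⟩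
  rintro c ⟨g, hg, hle, rfl⟩
  exact integral_mono hg hf hle

/-- A distribution of tasks `θ ∈ Θ`: MDPs with the same states, actions, initial law, dynamics and
discount factor, and with a reward function that depends on the task. -/
structure TaskDistribution (S A Θ : Type*) [MeasurableSpace S] [MeasurableSpace A]
    [MeasurableSpace Θ] where
  law : Measure Θ
  law_prob : IsProbabilityMeasure law
  init : Measure S
  init_prob : IsProbabilityMeasure init
  trans : Kernel (S × A) S
  trans_markov : IsMarkovKernel trans
  reward : Θ → S × A → ℝ
  reward_measurable : Measurable (Function.uncurry reward)
  discount : ℝ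
  discount_pos : 0 < discount
  discount_lt_one : discount < 1

attribute [instance] TaskDistribution.law_prob

namespace TaskDistribution

variable {S A Θ : Type*} [MeasurableSpace S] [MeasurableSpace A] [MeasurableSpace Θ]

/-- The MDP of the task `θ`. -/
def task (D : TaskDistribution S A Θ) (θ : Θ) : MDP S A where
  init := D.init
  init_prob := D.init_prob
  trans := D.trans
  trans_markov := D.trans_markov
  reward := D.reward θ
  reward_measurable := D.reward_measurable.comp measurable_prodMk_left
  discount := D.discount
  discount_pos := D.discount_pos
  discount_lt_one := D.discount_lt_one

/-- The average MDP, whose reward function is the mean of the reward functions of the tasks. -/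
def average (D : TaskDistribution S A Θ) : MDP S A where
  init := D.init
  init_prob := D.init_prob
  trans := D.trans
  trans_markov := D.trans_markov
  reward := fun x => ∫ θ, D.reward θ x ∂D.law
  reward_measurable :=
    (D.reward_measurable.stronglyMeasurable.integral_prod_left'
      (μ := D.law)).measurable
  discount := D.discount
  discount_pos := D.discount_pos
  discount_lt_one := D.discount_lt_one

/-- The expected return of `π` averaged over the tasks. -/
def meanValue (D : TaskDistribution S A Θ) (π : Policy S A) : ℝ :=
  ∫ θ, (D.task θ).value π ∂D.law

/-- The best mean return `sup_{π ∈ Π} E_θ[J_θ(π)]` over a policy class `Π`. -/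
def bestValue (D : TaskDistribution S A Θ) (P : Set (Policy S A)) : ℝ :=
  sSup (D.meanValue '' P)

/-- `J* = E_θ[sup_π J_θ(π)]`, the supremum being over all policies. -/
def optimalReturn (D : TaskDistribution S A Θ) : ℝ :=
  lowerExpectation D.law (fun θ => (D.task θ).optValue)

end TaskDistribution

end

/-! If a policy ignores rewards, the law of $(s_t,a_t)$ is the same in every task. Its return is
therefore $\int \mathcal R_{\mathcal M}\,d\rho$, where $\rho$ is the discounted occupation measure,
common to all tasks (`occupation_congr`, `value_eq_integral_occupation`). Fubini, with domination by
$C$, moves the mean over tasks inside.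

For Markovian policies, disintegrate $\rho=\rho_S\otimes\kappa$ and play $\kappa$ at all times. Both
$\rho_S$ and the state occupation of $\kappa$ solve the flow equation
$\beta=\mathrm{init}+\gamma\,\beta\kappa\mathcal P$. The latter is the Neumann series, hence the
least solution, and both have mass $(1-\gamma)^{-1}$, so they agree (`exists_markov_occupation_eq`).
The two classes thus have the same set of mean returns, which settles suprema and attainment
together.

The bound by $J^*_{\mathcal T}$ holds because $\mathcal M\mapsto J_{\mathcal M}(\pi)$ is itself an
integrable minorant of the optimal return. -/

namespace MDP

open scoped ENNReal

variable {S A : Type*} [MeasurableSpace S] [MeasurableSpace A]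

/-! ### One-step integration formulas for the trajectory law. -/

instance (M : MDP S A) (π : Policy S A) : IsProbabilityMeasure (M.trajLaw π) := by
  unfold trajLaw
  infer_instance

theorem lintegral_actKernel (M : MDP S A) (π : Policy S A) (t : ℕ)
    (h : (Fin t → Step S A) × S) {g : Step S A → ℝ≥0∞} (hg : Measurable g) :
    ∫⁻ x, g x ∂(M.actKernel π t h) =
      ∫⁻ a, g (h.2, a, M.reward (h.2, a)) ∂(π.kernel t h) := by
  have := M.reward_measurable
  rw [actKernel, Kernel.lintegral_map _ (by fun_prop) _ hg,
    Kernel.lintegral_id_prod (by fun_prop)]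

theorem lintegral_firstStep (M : MDP S A) (π : Policy S A) {g : Step S A → ℝ≥0∞}
    (hg : Measurable g) :
    ∫⁻ x, g x ∂(M.firstStep π) =
      ∫⁻ s, ∫⁻ a, g (s, a, M.reward (s, a)) ∂(π.kernel 0 (fun i => i.elim0, s)) ∂M.init := by
  rw [firstStep, Measure.lintegral_bind (Kernel.aemeasurable _) hg.aemeasurable,
    lintegral_map hg.lintegral_kernel (by fun_prop)]
  simp only [lintegral_actKernel _ _ _ _ hg]

theorem lintegral_nextStep (M : MDP S A) (π : Policy S A) (n : ℕ)
    (h : (i : Finset.Iic n) → Step S A) {g : Step S A → ℝ≥0∞} (hg : Measurable g) :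
    ∫⁻ x, g x ∂(M.nextStep π n h) =
      ∫⁻ s, ∫⁻ a, g (s, a, M.reward (s, a)) ∂(π.kernel (n + 1) (pastSteps n h, s))
        ∂(M.trans (lastPair n h)) := by
  rw [nextStep, Kernel.lintegral_comp _ _ _ hg,
    Kernel.lintegral_deterministic_prod (measurable_pastSteps n) _ h hg.lintegral_kernel, Kernel.comap_apply]
  simp only [lintegral_actKernel _ _ _ _ hg]

theorem lintegral_trajLaw_zero (M : MDP S A) (π : Policy S A) {g : Step S A → ℝ≥0∞}
    (hg : Measurable g) :
    ∫⁻ τ, g (τ 0) ∂(M.trajLaw π) = ∫⁻ x, g x ∂(M.firstStep π) := by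
  have key : (M.trajLaw π).map (fun τ => τ 0) = M.firstStep π := by
    have h0 : (fun τ : ℕ → Step S A => τ 0) =
        (MeasurableEquiv.piUnique (fun _ : Finset.Iic 0 => Step S A)) ∘
          (Preorder.frestrictLe (π := fun _ => Step S A) 0) := by
      rfl
    rw [h0, ← Measure.map_map (by fun_prop) (by fun_prop), trajLaw, Kernel.trajMeasure,
      Measure.map_comp _ _ (by fun_prop), Kernel.traj_map_frestrictLe, Kernel.partialTraj_self,
      Measure.id_comp, Measure.map_map (by fun_prop) (by fun_prop)]
    convert Measure.map_id
    ext x : 1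
    simp
  rw [← key, lintegral_map hg (by fun_prop)]

theorem lintegral_trajLaw_succ (M : MDP S A) (π : Policy S A) (n : ℕ)
    {g : ((i : Finset.Iic n) → Step S A) × Step S A → ℝ≥0∞} (hg : Measurable g) :
    ∫⁻ τ, g (Preorder.frestrictLe (π := fun _ => Step S A) n τ, τ (n + 1)) ∂(M.trajLaw π) =
      ∫⁻ τ, ∫⁻ x, g (Preorder.frestrictLe (π := fun _ => Step S A) n τ, x)
        ∂(M.nextStep π n (Preorder.frestrictLe (π := fun _ => Step S A) n τ))
        ∂(M.trajLaw π) := by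
  have key := Kernel.map_frestrictLe_trajMeasure_compProd_eq_map_trajMeasure
    (X := fun _ => Step S A) (μ₀ := M.firstStep π) (κ := M.nextStep π) (a := n)
  have h1 := congrArg (fun μ => ∫⁻ p, g p ∂μ) key
  rw [lintegral_map hg (by fun_prop), Measure.lintegral_compProd hg,
    lintegral_map (Measurable.lintegral_kernel_prod_right' hg) (by fun_prop)] at h1
  exact h1.symm

/-! ### Dependence of the trajectory law on the rewards. -/

/-- Replace the recorded reward of a step by the reward of `M`. -/
def relabel (M : MDP S A) (x : Step S A) : Step S A := (x.1, x.2.1, M.reward (x.1, x.2.1))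

theorem measurable_relabel (M : MDP S A) : Measurable M.relabel := by
  have := M.reward_measurable
  unfold relabel
  fun_prop

/-- For a policy that ignores rewards, the law of the trajectory up to time `n` in `M` is obtained
from the one in any MDP with the same dynamics by recomputing the rewards. -/
theorem lintegral_history_relabel (M N : MDP S A) (hinit : M.init = N.init)
    (htrans : M.trans = N.trans) {π : Policy S A} (hπ : π ∈ stateActionPolicies S A) (n : ℕ)
    {g : ((i : Finset.Iic n) → Step S A) → ℝ≥0∞} (hg : Measurable g) :
    ∫⁻ τ, g (Preorder.frestrictLe (π := fun _ => Step S A) n τ) ∂(M.trajLaw π) =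
      ∫⁻ τ, g (fun i => M.relabel (τ i)) ∂(N.trajLaw π) := by
  have hrel := M.measurable_relabel
  induction n with
  | zero =>
    have hu : ∀ τ : ℕ → Step S A, Preorder.frestrictLe (π := fun _ => Step S A) 0 τ =
        fun _ => τ 0 := by
      intro τ
      ext1 ⟨i, hi⟩
      obtain rfl : i = 0 := by simpa using hi
      rfl
    have hu' : ∀ τ : ℕ → Step S A, (fun i : Finset.Iic 0 => M.relabel (τ i)) =
        fun _ => M.relabel (τ 0) := by
      intro τ
      ext1 ⟨i, hi⟩
      obtain rfl : i = 0 := by simpa using hi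
      rfl
    simp only [hu, hu']
    rw [M.lintegral_trajLaw_zero π (g := fun x => g fun _ => x) (by fun_prop),
      N.lintegral_trajLaw_zero π (g := fun x => g fun _ => M.relabel x) (by fun_prop),
      lintegral_firstStep _ _ (by fun_prop), lintegral_firstStep _ _ (by fun_prop), hinit]
    rfl
  | succ n ih =>
    obtain ⟨κ, hκ, hπκ⟩ := hπ
    let e : ((i : Finset.Iic n) → Step S A) × Step S A → (i : Finset.Iic (n + 1)) → Step S A :=
      fun p i => if hi : (i : ℕ) ≤ n then p.1 ⟨i, Finset.mem_Iic.2 hi⟩ else p.2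
    have he : Measurable e := by
      refine measurable_pi_lambda _ fun i => ?_
      by_cases hi : (i : ℕ) ≤ n <;> simp only [e, hi, dite_true, dite_false] <;> fun_prop
    have h1 : ∀ τ : ℕ → Step S A, Preorder.frestrictLe (π := fun _ => Step S A) (n + 1) τ =
        e (Preorder.frestrictLe (π := fun _ => Step S A) n τ, τ (n + 1)) := by
      intro τ
      ext1 ⟨i, hi⟩
      by_cases h : i ≤ n
      · simp [e, h]
      · obtain rfl : i = n + 1 := by have := Finset.mem_Iic.1 hi; omega
        simp [e]
    have h2 : ∀ τ : ℕ → Step S A, (fun i : Finset.Iic (n + 1) => M.relabel (τ i)) =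
        e (fun i => M.relabel (Preorder.frestrictLe (π := fun _ => Step S A) n τ i),
          M.relabel (τ (n + 1))) := by
      intro τ
      ext1 ⟨i, hi⟩
      by_cases h : i ≤ n
      · simp [e, h]
      · obtain rfl : i = n + 1 := by have := Finset.mem_Iic.1 hi; omega
        simp [e]
    simp only [h1, h2]
    rw [M.lintegral_trajLaw_succ π n (g := fun p => g (e p)) (by fun_prop),
      N.lintegral_trajLaw_succ π n
        (g := fun p => g (e (fun i => M.relabel (p.1 i), M.relabel p.2))) (by fun_prop),
      ih (g := fun h => ∫⁻ x, g (e (h, x)) ∂(M.nextStep π n h))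
        (Measurable.lintegral_kernel_prod_right' (f := fun p => g (e p)) (by fun_prop))]
    refine lintegral_congr fun τ => ?_
    rw [lintegral_nextStep _ _ _ _ (by fun_prop), lintegral_nextStep _ _ _ _ (by fun_prop)]
    -- Relabelling keeps states and actions, so both sides feed the same data to `κ` and to the
    -- transition kernel.
    simp only [hπκ, Kernel.comap_apply, htrans]
    rfl

/-- The recorded rewards are almost surely those of `M`. -/
theorem ae_reward_eq (M : MDP S A) (π : Policy S A) (t : ℕ) :
    ∀ᵐ τ ∂(M.trajLaw π), (τ t).2.2 = M.reward ((τ t).1, (τ t).2.1) := by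
  have hR := M.reward_measurable
  let B : Set (Step S A) := {x | x.2.2 = M.reward (x.1, x.2.1)}ᶜ
  have hB : MeasurableSet B := (measurableSet_eq_fun (by fun_prop) (by fun_prop)).compl
  have hg : Measurable (B.indicator (1 : Step S A → ℝ≥0∞)) := measurable_one.indicator hB
  have h0 : ∫⁻ τ, B.indicator 1 (τ t) ∂(M.trajLaw π) = 0 := by
    cases t with
    | zero =>
      rw [M.lintegral_trajLaw_zero π hg, lintegral_firstStep _ _ hg]
      simp [B]
    | succ n =>
      rw [M.lintegral_trajLaw_succ π n (g := fun p => B.indicator 1 p.2) (by fun_prop)]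
      simp only [lintegral_nextStep _ _ _ _ hg]
      simp [B]
  rw [lintegral_eq_zero_iff (by fun_prop)] at h0
  filter_upwards [h0] with τ hτ
  by_contra h
  simp [B, h] at hτ

theorem lintegral_state_zero (M : MDP S A) (π : Policy S A) {g : S → ℝ≥0∞} (hg : Measurable g) :
    ∫⁻ τ, g (τ 0).1 ∂(M.trajLaw π) = ∫⁻ s, g s ∂M.init := by
  rw [M.lintegral_trajLaw_zero π (g := fun x => g x.1) (by fun_prop),
    lintegral_firstStep _ _ (by fun_prop)]
  simp

theorem lintegral_state_succ (M : MDP S A) (π : Policy S A) (n : ℕ) {g : S → ℝ≥0∞}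
    (hg : Measurable g) :
    ∫⁻ τ, g (τ (n + 1)).1 ∂(M.trajLaw π) =
      ∫⁻ τ, ∫⁻ s, g s ∂(M.trans ((τ n).1, (τ n).2.1)) ∂(M.trajLaw π) := by
  rw [M.lintegral_trajLaw_succ π n (g := fun p => g p.2.1) (by fun_prop)]
  refine lintegral_congr fun τ => ?_
  rw [lintegral_nextStep _ _ _ _ (g := fun x => g x.1) (by fun_prop)]
  simp
  rfl

/-- The past enters the action law only through the current state, so it can be integrated out. -/
theorem lintegral_pair_of_markov (M : MDP S A) {π : Policy S A} {κ : Kernel S A}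
    [IsMarkovKernel κ] (hπ : ∀ t, π.kernel t = κ.comap Prod.snd measurable_snd) (t : ℕ)
    {g : S × A → ℝ≥0∞} (hg : Measurable g) :
    ∫⁻ τ, g ((τ t).1, (τ t).2.1) ∂(M.trajLaw π) =
      ∫⁻ τ, ∫⁻ a, g ((τ t).1, a) ∂(κ (τ t).1) ∂(M.trajLaw π) := by
  have hG : Measurable fun s => ∫⁻ a, g (s, a) ∂(κ s) := hg.lintegral_kernel_prod_right'
  cases t with
  | zero =>
    rw [M.lintegral_state_zero π hG,
      M.lintegral_trajLaw_zero π (g := fun x => g (x.1, x.2.1)) (by fun_prop),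
      lintegral_firstStep _ _ (by fun_prop)]
    simp [hπ, Kernel.comap_apply]
  | succ n =>
    rw [M.lintegral_state_succ π n hG,
      M.lintegral_trajLaw_succ π n (g := fun p => g (p.2.1, p.2.2.1)) (by fun_prop)]
    refine lintegral_congr fun τ => ?_
    rw [lintegral_nextStep _ _ _ _ (g := fun x => g (x.1, x.2.1)) (by fun_prop)]
    simp only [hπ, Kernel.comap_apply]
    rfl

/-! ### Occupation measures and returns. -/

/-- The law of the state and action at time `t`. -/
noncomputable def pairLaw (M : MDP S A) (π : Policy S A) (t : ℕ) : Measure (S × A) :=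
  (M.trajLaw π).map fun τ => ((τ t).1, (τ t).2.1)

instance (M : MDP S A) (π : Policy S A) (t : ℕ) : IsProbabilityMeasure (M.pairLaw π t) :=
  Measure.isProbabilityMeasure_map (by fun_prop)

theorem lintegral_pairLaw (M : MDP S A) (π : Policy S A) (t : ℕ) {g : S × A → ℝ≥0∞}
    (hg : Measurable g) :
    ∫⁻ x, g x ∂(M.pairLaw π t) = ∫⁻ τ, g ((τ t).1, (τ t).2.1) ∂(M.trajLaw π) :=
  lintegral_map hg (by fun_prop)

/-- The law of the state and action at time `t` under a policy that ignores rewards does not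
depend on the reward function. -/
theorem pairLaw_congr (M N : MDP S A) (hinit : M.init = N.init) (htrans : M.trans = N.trans)
    {π : Policy S A} (hπ : π ∈ stateActionPolicies S A) (t : ℕ) :
    M.pairLaw π t = N.pairLaw π t := by
  refine Measure.ext_of_lintegral _ fun g hg => ?_
  rw [lintegral_pairLaw _ _ _ hg, lintegral_pairLaw _ _ _ hg]
  exact lintegral_history_relabel M N hinit htrans hπ t
    (g := fun h => g (lastPair t h)) (hg.comp (measurable_lastPair t))

/-- The (unnormalized) discounted occupation measure of the state-action pairs. -/
noncomputable def occupation (M : MDP S A) (π : Policy S A) : Measure (S × A) :=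
  Measure.sum fun t => ENNReal.ofReal M.discount ^ t • M.pairLaw π t

theorem occupation_congr (M N : MDP S A) (hinit : M.init = N.init) (htrans : M.trans = N.trans)
    (hdisc : M.discount = N.discount) {π : Policy S A} (hπ : π ∈ stateActionPolicies S A) :
    M.occupation π = N.occupation π := by
  simp only [occupation, hdisc, pairLaw_congr M N hinit htrans hπ]

theorem lintegral_occupation (M : MDP S A) (π : Policy S A) {g : S × A → ℝ≥0∞}
    (hg : Measurable g) :
    ∫⁻ x, g x ∂(M.occupation π) =
      ∑' t, ENNReal.ofReal M.discount ^ t * ∫⁻ τ, g ((τ t).1, (τ t).2.1) ∂(M.trajLaw π) := by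
  simp only [occupation, lintegral_sum_measure, lintegral_smul_measure,
    lintegral_pairLaw _ _ _ hg, smul_eq_mul]

theorem occupation_univ (M : MDP S A) (π : Policy S A) :
    M.occupation π Set.univ = (1 - ENNReal.ofReal M.discount)⁻¹ := by
  rw [← lintegral_one, lintegral_occupation _ _ measurable_const]
  simp [ENNReal.tsum_geometric]

instance (M : MDP S A) (π : Policy S A) : IsFiniteMeasure (M.occupation π) := by
  refine ⟨?_⟩
  rw [occupation_univ, ENNReal.inv_lt_top, tsub_pos_iff_lt]
  simpa using M.discount_lt_one

theorem occupation_real_univ (M : MDP S A) (π : Policy S A) :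
    (M.occupation π).real Set.univ = (1 - M.discount)⁻¹ := by
  rw [measureReal_def, occupation_univ, ENNReal.toReal_inv, ENNReal.toReal_sub_of_le]
  · simp [M.discount_pos.le]
  · simpa using M.discount_lt_one.le
  · simp

/-- The return is the integral of the reward against the occupation measure. -/
theorem value_eq_integral_occupation (M : MDP S A) (π : Policy S A) {C : ℝ}
    (hC : ∀ x, |M.reward x| ≤ C) : M.value π = ∫ x, M.reward x ∂(M.occupation π) := by
  have hR := M.reward_measurable
  have hint (μ : Measure (S × A)) [IsFiniteMeasure μ] : Integrable M.reward μ :=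
    Integrable.of_bound hR.aestronglyMeasurable C (.of_forall hC)
  have hmeas (t : ℕ) : Measurable fun τ : ℕ → Step S A =>
      M.discount ^ t * M.reward ((τ t).1, (τ t).2.1) := by fun_prop
  have hbd (t : ℕ) (τ : ℕ → Step S A) :
      ‖M.discount ^ t * M.reward ((τ t).1, (τ t).2.1)‖ ≤ M.discount ^ t * C := by
    rw [norm_mul, norm_pow, Real.norm_of_nonneg M.discount_pos.le]
    exact mul_le_mul_of_nonneg_left (hC _) (pow_nonneg M.discount_pos.le _)
  have hinteg (t : ℕ) : Integrable (fun τ : ℕ → Step S A =>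
      M.discount ^ t * M.reward ((τ t).1, (τ t).2.1)) (M.trajLaw π) :=
    Integrable.of_bound (hmeas t).aestronglyMeasurable _ (.of_forall (hbd t))
  have hsum : Summable fun t : ℕ => M.discount ^ t * C :=
    (summable_geometric_of_lt_one M.discount_pos.le M.discount_lt_one).mul_right C
  have h1 : M.value π =
      ∫ τ, ∑' t, M.discount ^ t * M.reward ((τ t).1, (τ t).2.1) ∂(M.trajLaw π) := by
    -- `value` integrates the recorded rewards, which are functions of state and action only almost
    -- surely.
    refine integral_congr_ae ?_
    filter_upwards [ae_all_iff.2 (M.ae_reward_eq π)] with τ hτ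
    simp only [hτ]
  rw [h1, ← integral_tsum_of_summable_integral_norm hinteg, occupation,
    integral_sum_measure (hint (M.occupation π))]
  · refine tsum_congr fun t => ?_
    rw [integral_smul_measure, pairLaw, integral_map (by fun_prop) hR.aestronglyMeasurable,
      integral_const_mul, ENNReal.toReal_pow, ENNReal.toReal_ofReal M.discount_pos.le, smul_eq_mul]
  · refine hsum.of_nonneg_of_le (fun t => integral_nonneg fun _ => norm_nonneg _) fun t => ?_
    refine (integral_mono (hinteg t).norm (integrable_const _) (hbd t)).trans ?_
    simp

theorem abs_value_le (M : MDP S A) (π : Policy S A) {C : ℝ} (hC : ∀ x, |M.reward x| ≤ C) :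
    |M.value π| ≤ C * (1 - M.discount)⁻¹ := by
  rw [M.value_eq_integral_occupation π hC, ← M.occupation_real_univ π]
  exact norm_integral_le_of_norm_le_const (f := M.reward) (.of_forall hC)

/-! ### The flow equation and reduction to Markovian policies. -/

/-- The flow equation of the occupation measure. -/
theorem lintegral_fst_occupation (M : MDP S A) (π : Policy S A) {g : S → ℝ≥0∞}
    (hg : Measurable g) :
    ∫⁻ s, g s ∂(M.occupation π).fst = ∫⁻ s, g s ∂M.init +
      ENNReal.ofReal M.discount * ∫⁻ x, ∫⁻ s, g s ∂(M.trans x) ∂(M.occupation π) := by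
  rw [Measure.fst, lintegral_map hg measurable_fst,
    lintegral_occupation _ _ (by fun_prop), lintegral_occupation _ _ hg.lintegral_kernel,
    tsum_eq_zero_add' ENNReal.summable, ← ENNReal.tsum_mul_left]
  simp only [pow_zero, one_mul, lintegral_state_zero _ _ hg, lintegral_state_succ _ _ _ hg,
    pow_succ', mul_assoc]

/-- The same `κ` acts at every time, so the factorization survives the discounted sum. -/
theorem occupation_eq_compProd_of_markov (M : MDP S A) {π : Policy S A} {κ : Kernel S A}
    [IsMarkovKernel κ] (hπ : ∀ t, π.kernel t = κ.comap Prod.snd measurable_snd) :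
    M.occupation π = (M.occupation π).fst ⊗ₘ κ := by
  refine Measure.ext_of_lintegral _ fun g hg => ?_
  have hG : Measurable fun s => ∫⁻ a, g (s, a) ∂(κ s) := hg.lintegral_kernel_prod_right'
  rw [Measure.lintegral_compProd hg, Measure.fst, lintegral_map hG measurable_fst,
    lintegral_occupation _ _ hg,
    lintegral_occupation _ _ (g := fun x => ∫⁻ a, g (x.1, a) ∂(κ x.1)) (hG.comp measurable_fst)]
  simp only [M.lintegral_pair_of_markov hπ _ hg]

/-- A solution of the flow equation of a Markovian policy dominates the partial sums of its
discounted state laws. -/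
theorem sum_lintegral_state_le (M : MDP S A) {π : Policy S A} {κ : Kernel S A}
    [IsMarkovKernel κ] (hπ : ∀ t, π.kernel t = κ.comap Prod.snd measurable_snd) {β : Measure S}
    (hβ : ∀ g : S → ℝ≥0∞, Measurable g → ∫⁻ s, g s ∂β = ∫⁻ s, g s ∂M.init +
      ENNReal.ofReal M.discount * ∫⁻ s, ∫⁻ a, ∫⁻ s', g s' ∂(M.trans (s, a)) ∂(κ s) ∂β)
    (n : ℕ) {g : S → ℝ≥0∞} (hg : Measurable g) :
    ∑ t ∈ Finset.range n, ENNReal.ofReal M.discount ^ t * ∫⁻ τ, g (τ t).1 ∂(M.trajLaw π) ≤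
      ∫⁻ s, g s ∂β := by
  -- Removing time 0 leaves $\gamma$ times the shorter sum for the one-step image of `g`, so the
  -- test function must vary.
  induction n generalizing g with
  | zero => simp
  | succ n ih =>
    have hT : Measurable fun x : S × A => ∫⁻ s', g s' ∂(M.trans x) := hg.lintegral_kernel
    rw [Finset.sum_range_succ', hβ g hg, add_comm]
    simp only [pow_zero, one_mul, lintegral_state_zero _ _ hg, lintegral_state_succ _ _ _ hg,
      pow_succ', mul_assoc, ← Finset.mul_sum, M.lintegral_pair_of_markov hπ _ hT]
    gcongr
    exact ih hT.lintegral_kernel_prod_right'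

theorem fst_occupation_le (M : MDP S A) {π : Policy S A} {κ : Kernel S A}
    [IsMarkovKernel κ] (hπ : ∀ t, π.kernel t = κ.comap Prod.snd measurable_snd) {β : Measure S}
    (hβ : ∀ g : S → ℝ≥0∞, Measurable g → ∫⁻ s, g s ∂β = ∫⁻ s, g s ∂M.init +
      ENNReal.ofReal M.discount * ∫⁻ s, ∫⁻ a, ∫⁻ s', g s' ∂(M.trans (s, a)) ∂(κ s) ∂β) :
    (M.occupation π).fst ≤ β := by
  refine Measure.le_iff.2 fun B hB => ?_
  have hg : Measurable (B.indicator (1 : S → ℝ≥0∞)) := measurable_one.indicator hB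
  rw [← lintegral_indicator_one hB, ← lintegral_indicator_one hB, Measure.fst,
    lintegral_map hg measurable_fst, lintegral_occupation _ _ (by fun_prop)]
  exact ENNReal.tsum_le_of_sum_range_le fun n => M.sum_lintegral_state_le hπ hβ n hg

/-- Every policy has the occupation measure of a Markovian policy. -/
theorem exists_markov_occupation_eq [StandardBorelSpace A] [Nonempty A] (M : MDP S A)
    (π : Policy S A) : ∃ π' ∈ markovPolicies S A, M.occupation π' = M.occupation π := by
  let κ := (M.occupation π).condKernel
  have hdis : (M.occupation π).fst ⊗ₘ κ = M.occupation π := (M.occupation π).disintegrate κ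
  let π' : Policy S A := ⟨fun _ => κ.comap Prod.snd measurable_snd, fun _ => inferInstance⟩
  have hπ' : ∀ t, π'.kernel t = κ.comap Prod.snd measurable_snd := fun _ => rfl
  refine ⟨π', ⟨κ, inferInstance, hπ'⟩, ?_⟩
  have hfst : (M.occupation π').fst = (M.occupation π).fst := by
    -- Domination between finite measures of equal total mass is equality; no separate uniqueness
    -- theorem for the flow equation is needed.
    refine Measure.eq_of_le_of_measure_univ_eq (M.fst_occupation_le hπ' fun g hg => ?_) ?_
    · rw [M.lintegral_fst_occupation π hg]
      congr 2
      conv_lhs => rw [← hdis]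
      rw [Measure.lintegral_compProd hg.lintegral_kernel]
    · rw [Measure.fst_univ, Measure.fst_univ, occupation_univ, occupation_univ]
  rw [M.occupation_eq_compProd_of_markov hπ', hfst, hdis]

end MDP

theorem markovPolicies_subset_stateActionPolicies (S A : Type*) [MeasurableSpace S]
    [MeasurableSpace A] : markovPolicies S A ⊆ stateActionPolicies S A := by
  rintro π ⟨κ, hκ, hπ⟩
  exact ⟨fun _ => κ.comap Prod.snd measurable_snd, fun _ => inferInstance, hπ⟩

/-! ### Averaging over tasks. -/

namespace TaskDistribution

variable {S A Θ : Type*} [MeasurableSpace S] [MeasurableSpace A] [MeasurableSpace Θ]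

theorem abs_average_reward_le (D : TaskDistribution S A Θ) {C : Θ → ℝ}
    (hC : Integrable C D.law) (hb : ∀ θ x, |D.reward θ x| ≤ C θ) (x : S × A) :
    |D.average.reward x| ≤ ∫ θ, C θ ∂D.law :=
  norm_integral_le_of_norm_le (f := fun θ => D.reward θ x) hC (.of_forall fun θ => hb θ x)

/-- The mean return of a policy that ignores rewards is its return in the average MDP. -/
theorem integrable_value_and_integral_eq (D : TaskDistribution S A Θ) {C : Θ → ℝ}
    (hC : Integrable C D.law) (hb : ∀ θ x, |D.reward θ x| ≤ C θ) {π : Policy S A}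
    (hπ : π ∈ stateActionPolicies S A) :
    Integrable (fun θ => (D.task θ).value π) D.law ∧
      ∫ θ, (D.task θ).value π ∂D.law = D.average.value π := by
  have hval (θ : Θ) : (D.task θ).value π = ∫ x, D.reward θ x ∂(D.average.occupation π) := by
    rw [(D.task θ).value_eq_integral_occupation π (hb θ),
      MDP.occupation_congr (D.task θ) D.average rfl rfl rfl hπ]
    rfl
  have hint : Integrable (Function.uncurry D.reward)
      (D.law.prod (D.average.occupation π)) :=
    (hC.comp_fst _).mono' D.reward_measurable.aestronglyMeasurable
      (.of_forall fun p => hb p.1 p.2)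
  have havg := D.abs_average_reward_le hC hb
  simp only [hval]
  refine ⟨hint.integral_prod_left, ?_⟩
  rw [D.average.value_eq_integral_occupation π havg]
  exact integral_integral_swap hint

/-- Mean returns are returns in the average MDP, and these depend on the policy only through its
occupation measure there. -/
theorem image_meanValue_markovPolicies [StandardBorelSpace A] [Nonempty A]
    (D : TaskDistribution S A Θ) {C : Θ → ℝ} (hC : Integrable C D.law)
    (hb : ∀ θ x, |D.reward θ x| ≤ C θ) :
    D.meanValue '' markovPolicies S A = D.meanValue '' stateActionPolicies S A := by
  refine (Set.image_mono (markovPolicies_subset_stateActionPolicies S A)).antisymm ?_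
  rintro _ ⟨π, hπ, rfl⟩
  obtain ⟨π', hπ', hocc⟩ := D.average.exists_markov_occupation_eq π
  have havg := D.abs_average_reward_le hC hb
  refine ⟨π', hπ', ?_⟩
  rw [meanValue, meanValue, (D.integrable_value_and_integral_eq hC hb hπ).2,
    (D.integrable_value_and_integral_eq hC hb
      (markovPolicies_subset_stateActionPolicies S A hπ')).2,
    D.average.value_eq_integral_occupation π havg,
    D.average.value_eq_integral_occupation π' havg, hocc]

theorem meanValue_le_optimalReturn (D : TaskDistribution S A Θ) {C : Θ → ℝ}
    (hC : Integrable C D.law) (hb : ∀ θ x, |D.reward θ x| ≤ C θ) {π : Policy S A}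
    (hπ : Integrable (fun θ => (D.task θ).value π) D.law) :
    D.meanValue π ≤ D.optimalReturn := by
  have hle (θ : Θ) (π : Policy S A) : (D.task θ).value π ≤ C θ * (1 - D.discount)⁻¹ :=
    (abs_le.1 ((D.task θ).abs_value_le π (hb θ))).2
  -- A real `sSup` needs an upper bound: every minorant lies below $C/(1-\gamma)$.
  refine le_csSup ⟨∫ θ, C θ * (1 - D.discount)⁻¹ ∂D.law, ?_⟩ ⟨_, hπ, fun θ => ?_, rfl⟩
  · rintro _ ⟨g, hg, hgle, rfl⟩
    have : Nonempty (Policy S A) := ⟨π⟩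
    exact integral_mono hg (hC.mul_const _) fun θ => (hgle θ).trans (ciSup_le (hle θ))
  · exact le_ciSup (f := fun π => (D.task θ).value π)
      ⟨_, Set.forall_mem_range.2 (hle θ)⟩ π

end TaskDistribution

theorem theorem2 {S A Θ : Type*} [MeasurableSpace S] [MeasurableSpace A] [MeasurableSpace Θ]
    [StandardBorelSpace A] [Nonempty A] (D : TaskDistribution S A Θ)
    (hbound : ∃ C : Θ → ℝ, Integrable C D.law ∧ ∀ θ x, |D.reward θ x| ≤ C θ) :
    (∀ π ∈ stateActionPolicies S A,
      Integrable (fun θ => (D.task θ).value π) D.law ∧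
        ∫ θ, (D.task θ).value π ∂D.law = D.average.value π) ∧
    D.bestValue (markovPolicies S A) = D.bestValue (stateActionPolicies S A) ∧
    (∀ v : ℝ, IsGreatest (D.meanValue '' markovPolicies S A) v ↔
      IsGreatest (D.meanValue '' stateActionPolicies S A) v) ∧
    D.bestValue (stateActionPolicies S A) ≤ D.optimalReturn := by
  obtain ⟨C, hC, hb⟩ := hbound
  have himg := D.image_meanValue_markovPolicies hC hb
  refine ⟨fun π hπ => D.integrable_value_and_integral_eq hC hb hπ, ?_, fun v => ?_, ?_⟩
  · rw [TaskDistribution.bestValue, himg, TaskDistribution.bestValue]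
  · rw [himg]
  · have a : A := Classical.arbitrary A
    -- `csSup_le` needs a nonempty set; always playing `a` provides a policy.
    have hne : (stateActionPolicies S A).Nonempty :=
      ⟨⟨fun _ => Kernel.const _ (Measure.dirac a), fun _ => inferInstance⟩,
        fun _ => Kernel.const _ (Measure.dirac a), fun _ => inferInstance, fun _ => rfl⟩
    refine csSup_le (hne.image _) ?_
    rintro _ ⟨π, hπ, rfl⟩
    exact D.meanValue_le_optimalReturn hC hb (D.integrable_value_and_integral_eq hC hb hπ).1
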